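/- An overpartition of $n\ge 0$ is a partition of $n$ in which the first occurrence of any part may be overlined. For a partition $\mu$ with $\omega$ parts equal to $1$, the crank $cr(\mu)$ is the largest part of $\mu$ if $\omega=0$ (and $0$ if $\mu$ is empty); otherwise it is the number of parts of $\mu$ exceeding $\omega$, minus $\omega$. For $d\ge1$ and an overpartition $\lambda$, let $\lambda'$ be the partition obtained by dividing by $d$ all non-overlined parts of $\lambda$ that are divisible by $d$; the $d$th residual crank of $\lambda$ is $cr(\lambda')$. Let $\overline{M[d]}(m,n)$ be the number of overpartitions of $n$ with $d$th residual crank $m$, where, following the usual convention for the crank of partitions of $1$, each overpartition with $\lambda'=(1)$ is counted with multiplicity $1$ at $m=1$, $-1$ at $m=0$, $1$ at $m=-1$, and $0$ at every other $m$. Let $$\overline{M[d]}^+_k(n)=\sum_{m\ge1} m^k\,\overline{M[d]}(m,n)$$ be the $k$th positive moment of the $d$th residual crank. Theorem. For all integers $d,k\ge1$ and $n\ge0$, $$\overline{M[d+1]}^+_k(n)\le \overline{M[d]}^+_k(n),$$ with equality if and only if $\overline{M[d]}^+_k(n)=0$, which occurs if and only if $n<d$. -/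

import Mathlib

/-- An overpartition of `n`: a partition of `n` in which the first occurrence of any part may be
overlined, i.e. a partition together with the set of part sizes whose first occurrence is
overlined. -/
@[ext]
structure Overpartition (n : ℕ) where
  /-- The underlying partition, with overlines forgotten. -/
  toPartition : n.Partition
  /-- The part sizes whose first occurrence is overlined. -/
  overlined : Finset ℕ
  /-- Only parts that occur can be overlined. -/
  overlined_subset : overlined ⊆ toPartition.parts.toFinset

namespace Overpartition

/-- Overpartitions as pairs. -/
def equivSigma (n : ℕ) :
    Overpartition n ≃ (Σ p : n.Partition, {s : Finset ℕ // s ∈ p.parts.toFinset.powerset}) where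
  toFun l := ⟨l.toPartition, l.overlined, Finset.mem_powerset.2 l.overlined_subset⟩
  invFun x := ⟨x.1, x.2.1, Finset.mem_powerset.1 x.2.2⟩
  left_inv _ := rfl
  right_inv _ := rfl

instance (n : ℕ) : Fintype (Overpartition n) := Fintype.ofEquiv _ (equivSigma n).symm

/-- The multiset of non-overlined parts: one copy of each overlined part is removed. -/
def nonOverlined {n : ℕ} (l : Overpartition n) : Multiset ℕ :=
  l.toPartition.parts - l.overlined.val

/-- The parts of the partition `λ'` attached to `λ` and `d`: the non-overlined parts divisible by
`d`, each divided by `d`. -/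
def residual {n : ℕ} (d : ℕ) (l : Overpartition n) : Multiset ℕ :=
  (l.nonOverlined.filter (d ∣ ·)).map (· / d)

end Overpartition

/-- The crank of the partition with multiset of parts `s`, where `ω` is the number of ones: the
largest part if `ω = 0` (so `0` for the empty partition), and otherwise the number of parts
exceeding `ω`, minus `ω`. -/
def crank (s : Multiset ℕ) : ℤ :=
  if s.count 1 = 0 then ((s.sup : ℕ) : ℤ)
  else ((s.filter (fun a => s.count 1 < a)).card : ℤ) - (s.count 1 : ℤ)

/-- The multiplicity with which the partition `s` is counted at crank `m`. This is `1` if `m` is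
the crank of `s` and `0` otherwise, except for the partition `(1)` of `1`, for which the usual
convention `M(1, 1) = M(-1, 1) = 1`, `M(0, 1) = -1` (the coefficients of `q` in the product
generating function of the crank) is used. -/
def crankWeight (m : ℤ) (s : Multiset ℕ) : ℤ :=
  if s = {1} then (if m = 1 ∨ m = -1 then 1 else if m = 0 then -1 else 0)
  else (if crank s = m then 1 else 0)

/-- The number of overpartitions of `n` with `d`th residual crank `m` (with the usual convention
for the crank of the partition `(1)`). -/
def residualCrankCount (d : ℕ) (m : ℤ) (n : ℕ) : ℤ :=
  ∑ l : Overpartition n, crankWeight m (l.residual d)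

/-- The `k`th positive moment of the `d`th residual crank of overpartitions of `n`, that is
`∑_{m ≥ 1} m ^ k * residualCrankCount d m n`. The terms with `m > n` vanish, by
`residualCrankCount_eq_zero` below. -/
def posMoment (d k n : ℕ) : ℤ :=
  ∑ m ∈ Finset.Icc 1 n, (m : ℤ) ^ k * residualCrankCount d (m : ℤ) n

theorem residualCrankCount_eq_zero (d m n : ℕ) (h : n < m) :
    residualCrankCount d (m : ℤ) n = 0 := by
  have hle : ∀ l : Overpartition n, l.nonOverlined ≤ l.toPartition.parts := fun l =>
    Multiset.sub_le_self _ _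
  unfold residualCrankCount
  refine Finset.sum_eq_zero fun l _ => ?_
  have hmem : ∀ a ∈ l.toPartition.parts, a ≤ n := fun a ha => by
    have := Multiset.single_le_sum (fun x _ => Nat.zero_le x) a ha
    rwa [l.toPartition.parts_sum] at this
  have hcard : l.toPartition.parts.card ≤ n := by
    have := Multiset.card_nsmul_le_sum (s := l.toPartition.parts) (a := 1)
      (fun x hx => l.toPartition.parts_pos hx)
    simpa [l.toPartition.parts_sum] using this
  have hrcard : (l.residual d).card ≤ n := by
    unfold Overpartition.residual
    rw [Multiset.card_map]
    exact (Multiset.card_le_card ((Multiset.filter_le _ _).trans (hle l))).trans hcard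
  have hrmem : ∀ a ∈ l.residual d, a ≤ n := by
    intro a ha
    unfold Overpartition.residual at ha
    obtain ⟨b, hb, rfl⟩ := Multiset.mem_map.1 ha
    exact (Nat.div_le_self b d).trans
      (hmem b (Multiset.mem_of_le (hle l) (Multiset.mem_filter.1 hb).1))
  unfold crankWeight
  split_ifs with h1 h2 h3 h4
  · exfalso
    have : 1 ≤ n := hrmem 1 (by simp [h1])
    rcases h2 with h2 | h2 <;> omega
  · omega
  · rfl
  · exfalso
    unfold crank at h4
    split_ifs at h4
    · have : (l.residual d).sup ≤ n := Multiset.sup_le.2 hrmem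
      omega
    · have := (Multiset.card_le_card
        (Multiset.filter_le (fun a => (l.residual d).count 1 < a) (l.residual d))).trans hrcard
      omega
  · rfl

/-!
The residual crank of an overpartition only sees the non-overlined parts divisible by `d`, which,
after division by `d`, form an arbitrary partition independent of everything else (`sum_residual`).
Hence if `A(q)` denotes the generating function of the positive crank moments of ordinary
partitions, divided by the generating function of all partitions, then the positive moments of the
`d`th residual crank have the generating function `A(q ^ d)` times that of all overpartitions:

  `posMoment d k n = ∑ N, A_N * (number of overpartitions of n - d * N)`  (`posMoment_eq_sum`).

The number of overpartitions is strictly increasing, so the theorem follows once `A_N ≥ 0`,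
`A_0 = 0` and `A_1 = 1`.

For this, `A` is expanded in partial theta series: with
`F_m = ∑ (-1) ^ i q ^ (m + (m + 1) + ⋯ + (m + i))`, the partitions with crank `m ≥ 1` are counted by
`F_m - F_{m+1}` times the generating function of all partitions (`crankGF_eq`). The crank generating
functions are sums of explicit products, obtained by sorting the partitions by their number of
ones, and satisfy a three-term recurrence in `m` (`crankGF_recurrence`). The partial theta side
satisfies the same recurrence because `F_m = q ^ m * (1 - F_{m+1})`, and the two sides agree to
growing order, which forces equality.

Thus `A = ∑ m ^ k * (F_m - F_{m+1})`. Two summations by parts, using that `m ^ k` is convex, reduce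
`A_N ≥ 0` to the nonnegativity of the coefficients of `∑_{m ≥ M} F_m`
(`sum_coeff_runTheta_nonneg`): among the representations of `N` as a sum of consecutive integers
starting at `M` or later, those of even length inject into those of odd length.

All series have coefficients in `ℤ`; infinite sums over `m` are cut off at a bound that does not
affect the coefficients under consideration.
-/

open PowerSeries Finset

/-! ### Weighted generating functions of partitions -/

/-- The multisets of positive integers with sum `n`, that is, the multisets of parts of the
partitions of `n`. Working with them rather than with `n.Partition` avoids dependent types. -/
def partsFinset (n : ℕ) : Finset (Multiset ℕ) :=
  (univ : Finset n.Partition).map ⟨Nat.Partition.parts, fun _ _ h => Nat.Partition.ext h⟩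

theorem mem_partsFinset {n : ℕ} {s : Multiset ℕ} : s ∈ partsFinset n ↔ 0 ∉ s ∧ s.sum = n := by
  simp only [partsFinset, Finset.mem_map, Finset.mem_univ, true_and]
  constructor
  · rintro ⟨p, rfl⟩
    exact ⟨fun h => (p.parts_pos h).ne rfl, p.parts_sum⟩
  · rintro ⟨h0, hs⟩
    exact ⟨⟨s, fun {i} hi => Nat.pos_of_ne_zero fun h => h0 (h ▸ hi), hs⟩, rfl⟩

/-- The generating function `∑ w(s) X ^ |s|` over all partitions `s`, weighted by `w`. -/
noncomputable def weightGF (w : Multiset ℕ → ℤ) : ℤ⟦X⟧ :=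
  PowerSeries.mk fun n => ∑ s ∈ partsFinset n, w s

open Classical in
/-- The generating function of the partitions whose multiset of parts satisfies `P`. -/
noncomputable def countGF (P : Multiset ℕ → Prop) : ℤ⟦X⟧ :=
  weightGF fun s => if P s then 1 else 0

theorem coeff_weightGF (w : Multiset ℕ → ℤ) (n : ℕ) :
    coeff n (weightGF w) = ∑ s ∈ partsFinset n, w s := coeff_mk _ _

theorem coeff_countGF (P : Multiset ℕ → Prop) [DecidablePred P] (n : ℕ) :
    coeff n (countGF P) = #{s ∈ partsFinset n | P s} := by
  rw [← Finset.sum_boole, countGF, coeff_weightGF]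
  congr!

theorem weightGF_congr {u v : Multiset ℕ → ℤ} (h : ∀ s, 0 ∉ s → u s = v s) :
    weightGF u = weightGF v := by
  ext n
  simp only [coeff_weightGF]
  exact Finset.sum_congr rfl fun s hs => h s (mem_partsFinset.1 hs).1

theorem weightGF_add (u v : Multiset ℕ → ℤ) :
    weightGF (fun s => u s + v s) = weightGF u + weightGF v := by
  ext n
  simp [coeff_weightGF, Finset.sum_add_distrib]

theorem countGF_congr {P Q : Multiset ℕ → Prop} (h : ∀ s, 0 ∉ s → (P s ↔ Q s)) :
    countGF P = countGF Q :=
  weightGF_congr fun s hs => by rw [propext (h s hs)]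

theorem countGF_split (P R : Multiset ℕ → Prop) :
    countGF P = countGF (fun s => P s ∧ R s) + countGF (fun s => P s ∧ ¬ R s) := by
  rw [countGF, countGF, countGF, ← weightGF_add]
  refine weightGF_congr fun s _ => ?_
  by_cases hP : P s <;> by_cases hR : R s <;> simp [hP, hR]

theorem countGF_eq_zero {P : Multiset ℕ → Prop} (h : ∀ s, 0 ∉ s → ¬ P s) : countGF P = 0 := by
  classical
  ext n
  rw [coeff_countGF, Finset.filter_false_of_mem fun s hs => h s (mem_partsFinset.1 hs).1]
  simp

/-- A bijection from the partitions satisfying `P` to those satisfying `Q` that raises the size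
by `c` multiplies the generating function by `X ^ c`. -/
theorem countGF_shift {P Q : Multiset ℕ → Prop} (c : ℕ) (f g : Multiset ℕ → Multiset ℕ)
    (hf : ∀ s, 0 ∉ s → P s → 0 ∉ f s ∧ Q (f s) ∧ (f s).sum = s.sum + c ∧ g (f s) = s)
    (hg : ∀ t, 0 ∉ t → Q t → 0 ∉ g t ∧ P (g t) ∧ f (g t) = t) :
    countGF Q = X ^ c * countGF P := by
  classical
  have hsum : ∀ t, 0 ∉ t → Q t → t.sum = (g t).sum + c := fun t h0 hQ => by
    obtain ⟨h1, h2, h3⟩ := hg t h0 hQ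
    rw [← (hf _ h1 h2).2.2.1, h3]
  ext n
  rw [coeff_X_pow_mul']
  split_ifs with hc
  · rw [coeff_countGF, coeff_countGF, Nat.cast_inj]
    refine Finset.card_nbij' g f ?_ ?_ ?_ ?_
    · intro t ht
      simp only [Finset.coe_filter, mem_partsFinset, Set.mem_ofPred_eq] at ht ⊢
      obtain ⟨⟨h0, hn⟩, hQ⟩ := ht
      have := hsum t h0 hQ
      exact ⟨⟨(hg t h0 hQ).1, by omega⟩, (hg t h0 hQ).2.1⟩
    · intro s hs
      simp only [Finset.coe_filter, mem_partsFinset, Set.mem_ofPred_eq] at hs ⊢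
      obtain ⟨⟨h0, hn⟩, hP⟩ := hs
      have := (hf s h0 hP).2.2.1
      exact ⟨⟨(hf s h0 hP).1, by omega⟩, (hf s h0 hP).2.1⟩
    · intro t ht
      simp only [Finset.coe_filter, mem_partsFinset, Set.mem_ofPred_eq] at ht
      exact (hg t ht.1.1 ht.2).2.2
    · intro s hs
      simp only [Finset.coe_filter, mem_partsFinset, Set.mem_ofPred_eq] at hs
      exact (hf s hs.1.1 hs.2).2.2.2
  · rw [coeff_countGF, Finset.filter_false_of_mem, Finset.card_empty, Nat.cast_zero]
    intro t ht hQ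
    rw [mem_partsFinset] at ht
    have := hsum t ht.1 hQ
    omega

/-- Splitting the parts of a partition according to a predicate `A` makes a weight that factors
over the two pieces into a product of generating functions. -/
theorem weightGF_mul (A : ℕ → Prop) [DecidablePred A] (u v : Multiset ℕ → ℤ) :
    weightGF (fun s => u (s.filter A) * v (s.filter (¬ A ·))) =
      weightGF (fun s => if ∀ a ∈ s, A a then u s else 0) *
      weightGF (fun s => if ∀ a ∈ s, ¬ A a then v s else 0) := by
  ext n
  rw [coeff_mul, coeff_weightGF]
  simp only [coeff_weightGF, ← Finset.sum_filter, Finset.sum_mul_sum, ← Finset.sum_product']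
  rw [Finset.sum_sigma']
  refine Finset.sum_nbij' (fun s => ⟨((s.filter A).sum, (s.filter (¬ A ·)).sum),
    (s.filter A, s.filter (¬ A ·))⟩) (fun x => x.2.1 + x.2.2) ?_ ?_ ?_ ?_ ?_
  · intro s hs
    rw [mem_partsFinset] at hs
    have h := congrArg Multiset.sum (Multiset.filter_add_not A s)
    rw [Multiset.sum_add] at h
    simp only [Finset.mem_sigma, Finset.mem_filter, Finset.mem_product, mem_partsFinset,
      Multiset.mem_filter]
    exact ⟨mem_antidiagonal.2 (h.trans hs.2), ⟨⟨fun h => hs.1 h.1, trivial⟩, fun a ha => ha.2⟩,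
      ⟨fun h => hs.1 h.1, trivial⟩, fun a ha => ha.2⟩
  · rintro ⟨⟨a, b⟩, ⟨s, t⟩⟩ hx
    simp only [Finset.mem_sigma, Finset.mem_filter, Finset.mem_product, mem_partsFinset] at hx ⊢
    obtain ⟨hab, ⟨⟨hs0, rfl⟩, hA⟩, ⟨ht0, rfl⟩, hB⟩ := hx
    exact ⟨by simp [hs0, ht0], by rw [Multiset.sum_add, mem_antidiagonal.1 hab]⟩
  · intro s _
    exact Multiset.filter_add_not A s
  · rintro ⟨⟨a, b⟩, ⟨s, t⟩⟩ hx
    simp only [Finset.mem_sigma, Finset.mem_filter, Finset.mem_product, mem_partsFinset] at hx ⊢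
    obtain ⟨hab, ⟨⟨hs0, rfl⟩, hA⟩, ⟨ht0, rfl⟩, hB⟩ := hx
    have h1 : (s + t).filter A = s := by
      rw [Multiset.filter_add, Multiset.filter_eq_self.2 hA, Multiset.filter_eq_nil.2 hB, add_zero]
    have h2 : (s + t).filter (¬ A ·) = t := by
      rw [Multiset.filter_add, Multiset.filter_eq_self.2 hB,
        Multiset.filter_eq_nil.2 fun a ha => not_not.2 (hA a ha), zero_add]
    rw [h1, h2]
  · intro s _
    rfl

theorem countGF_mul (A : ℕ → Prop) [DecidablePred A] (P Q : Multiset ℕ → Prop) :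
    countGF (fun s => P (s.filter A) ∧ Q (s.filter (¬ A ·))) =
      countGF (fun s => (∀ a ∈ s, A a) ∧ P s) * countGF (fun s => (∀ a ∈ s, ¬ A a) ∧ Q s) := by
  classical
  have h := weightGF_mul A (fun s => if P s then 1 else 0) (fun s => if Q s then 1 else 0)
  have hand : ∀ (p q : Prop) [Decidable p] [Decidable q] [Decidable (p ∧ q)],
      (if p ∧ q then (1 : ℤ) else 0) = (if p then 1 else 0) * (if q then 1 else 0) := by
    intro p q _ _ _
    by_cases hp : p <;> by_cases hq : q <;> simp [hp, hq]
  simp only [countGF, hand]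
  rw [h]
  congr 2 <;> ext s <;> split_ifs <;> simp

/-! ### Partitions with restricted part sizes or number of parts -/

theorem countGF_eq_empty : countGF (fun s => s = 0) = 1 := by
  ext n
  rw [coeff_countGF, coeff_one]
  split_ifs with hn
  · rw [Nat.cast_eq_one, Finset.card_eq_one]
    refine ⟨0, Finset.ext fun s => ?_⟩
    rw [Finset.mem_filter, Finset.mem_singleton, mem_partsFinset]
    exact ⟨fun h => h.2, fun h => by simp [h, hn]⟩
  · rw [Finset.filter_false_of_mem, Finset.card_empty, Nat.cast_zero]
    rintro s hs rfl
    exact hn (mem_partsFinset.1 hs).2.symm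

/-- Removing one copy of the part `a`. -/
theorem countGF_mem {P Q : Multiset ℕ → Prop} {a : ℕ} (ha : a ≠ 0) (h : ∀ s, P (a ::ₘ s) ↔ Q s) :
    countGF (fun s => P s ∧ a ∈ s) = X ^ a * countGF Q := by
  refine countGF_shift a (fun s => a ::ₘ s) (fun s => s.erase a) ?_ ?_
  · intro s h0 hs
    refine ⟨?_, ⟨(h s).2 hs, Multiset.mem_cons_self a s⟩, by simp [add_comm], by simp⟩
    rw [Multiset.mem_cons]
    rintro (h | h)
    exacts [ha h.symm, h0 h]
  · rintro t h0 ⟨hP, hat⟩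
    have ht := Multiset.cons_erase hat
    exact ⟨fun h => h0 (Multiset.mem_of_mem_erase h), (h _).1 (ht.symm ▸ hP), ht⟩

/-- The generating function `1 / ((1 - X) ⋯ (1 - X ^ m))` of partitions into parts at most `m`. -/
noncomputable def partsLeGF (m : ℕ) : ℤ⟦X⟧ := countGF fun s => ∀ a ∈ s, a ≤ m

theorem partsLeGF_zero : partsLeGF 0 = 1 := by
  rw [← countGF_eq_empty]
  refine countGF_congr fun s h0 => ⟨fun h => ?_, fun h => by simp [h]⟩
  exact Multiset.eq_zero_of_forall_notMem fun a ha => h0 (Nat.le_zero.1 (h a ha) ▸ ha)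

theorem one_sub_mul_partsLeGF (m : ℕ) :
    (1 - X ^ (m + 1)) * partsLeGF (m + 1) = partsLeGF m := by
  have h1 : countGF (fun s => (∀ a ∈ s, a ≤ m + 1) ∧ m + 1 ∈ s) =
      X ^ (m + 1) * partsLeGF (m + 1) :=
    countGF_mem (P := fun s => ∀ a ∈ s, a ≤ m + 1) m.succ_ne_zero fun s => by simp
  have h2 : countGF (fun s => (∀ a ∈ s, a ≤ m + 1) ∧ m + 1 ∉ s) = partsLeGF m := by
    refine countGF_congr fun s _ => ⟨fun h a ha => ?_, fun h => ⟨fun a ha => ?_, fun ha => ?_⟩⟩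
    · have := h.1 a ha
      have : a ≠ m + 1 := fun hh => h.2 (hh ▸ ha)
      omega
    · exact (h a ha).trans m.le_succ
    · exact absurd (h _ ha) (by omega)
  have h3 := countGF_split (fun s => ∀ a ∈ s, a ≤ m + 1) (fun s => m + 1 ∈ s)
  rw [h1, h2] at h3
  change partsLeGF (m + 1) = _ at h3
  linear_combination h3

theorem countGF_le_and_one_notMem {j : ℕ} (hj : 1 ≤ j) :
    countGF (fun s => (∀ a ∈ s, a ≤ j) ∧ 1 ∉ s) = (1 - X) * partsLeGF j := by
  have h1 : countGF (fun s => (∀ a ∈ s, a ≤ j) ∧ 1 ∈ s) = X ^ 1 * partsLeGF j :=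
    countGF_mem (P := fun s => ∀ a ∈ s, a ≤ j) one_ne_zero fun s => by simp [hj]
  have h3 := countGF_split (fun s => ∀ a ∈ s, a ≤ j) (fun s => 1 ∈ s)
  rw [h1] at h3
  change partsLeGF j = _ at h3
  linear_combination -h3

/-- The generating function of partitions into exactly `i` parts, all greater than `j`. -/
noncomputable def cardGF (i j : ℕ) : ℤ⟦X⟧ := countGF fun s => s.card = i ∧ ∀ a ∈ s, j < a

theorem cardGF_succ_right (i j : ℕ) : cardGF i (j + 1) = X ^ i * cardGF i j := by
  refine countGF_shift i (Multiset.map (· + 1)) (Multiset.map (· - 1)) ?_ ?_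
  · rintro s - ⟨hc, hs⟩
    refine ⟨by simp, ⟨by simpa using hc, ?_⟩, ?_, by simp⟩
    · simp only [Multiset.mem_map, forall_exists_index, and_imp, forall_apply_eq_imp_iff₂]
      exact fun a ha => Nat.succ_lt_succ (hs a ha)
    · rw [Multiset.sum_map_add]
      simp [hc]
  · rintro t - ⟨hc, ht⟩
    have h : ∀ a ∈ t.map (· - 1), j < a := by
      simp only [Multiset.mem_map, forall_exists_index, and_imp, forall_apply_eq_imp_iff₂]
      exact fun a ha => by have := ht a ha; omega
    refine ⟨fun h0 => Nat.not_lt_zero _ (h 0 h0), ⟨by simpa using hc, h⟩, ?_⟩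
    rw [Multiset.map_map]
    conv_rhs => rw [← Multiset.map_id t]
    exact Multiset.map_congr rfl fun a ha => by have := ht a ha; simp only [Function.comp, id]; omega

theorem cardGF_succ_zero (i : ℕ) :
    cardGF (i + 1) 0 = X * cardGF i 0 + X ^ (i + 1) * cardGF (i + 1) 0 := by
  rw [← cardGF_succ_right]
  have h1 : countGF (fun s => (s.card = i + 1 ∧ ∀ a ∈ s, 0 < a) ∧ 1 ∈ s) = X ^ 1 * cardGF i 0 :=
    countGF_mem (P := fun s => s.card = i + 1 ∧ ∀ a ∈ s, 0 < a) one_ne_zero fun s => by simp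
  have h2 : countGF (fun s => (s.card = i + 1 ∧ ∀ a ∈ s, 0 < a) ∧ 1 ∉ s) =
      cardGF (i + 1) (0 + 1) := by
    refine countGF_congr fun s _ => ⟨fun h => ⟨h.1.1, fun a ha => ?_⟩,
      fun h => ⟨⟨h.1, fun a ha => ?_⟩, fun ha => ?_⟩⟩
    · have := h.1.2 a ha
      have : a ≠ 1 := fun hh => h.2 (hh ▸ ha)
      omega
    · have := h.2 a ha
      omega
    · exact absurd (h.2 1 ha) (by omega)
  have h3 := countGF_split (fun s => s.card = i + 1 ∧ ∀ a ∈ s, 0 < a) (fun s => 1 ∈ s)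
  rw [h1, h2, pow_one] at h3
  exact h3

theorem one_sub_X_pow_ne_zero (m : ℕ) : (1 - X ^ (m + 1) : ℤ⟦X⟧) ≠ 0 := by
  intro h
  have := congrArg (coeff 0) h
  simp at this

/-- Partitions into `i` parts correspond, up to `X ^ i`, to partitions into parts at most `i`; both
sides satisfy the same recursion in `i`. -/
theorem cardGF_zero_right (i : ℕ) : cardGF i 0 = X ^ i * partsLeGF i := by
  induction i with
  | zero =>
    rw [partsLeGF_zero, pow_zero, one_mul, ← countGF_eq_empty]
    exact countGF_congr fun s _ => ⟨fun h => Multiset.card_eq_zero.1 h.1, fun h => by simp [h]⟩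
  | succ i ih =>
    refine mul_left_cancel₀ (one_sub_X_pow_ne_zero i) ?_
    linear_combination cardGF_succ_zero i + X * ih - X ^ (i + 1) * one_sub_mul_partsLeGF i

theorem cardGF_eq (i j : ℕ) : cardGF i j = X ^ ((j + 1) * i) * partsLeGF i := by
  induction j with
  | zero => rw [cardGF_zero_right, zero_add, one_mul]
  | succ j ih => rw [cardGF_succ_right, ih, ← mul_assoc, ← pow_add]; congr 2; ring

/-! ### The generating function of the crank -/

/-- The contribution of the partitions with exactly `j` ones (for `j = 0` with the conventional
correction at the partition `(1)`) to the generating function of the partitions with crank `m`. -/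
noncomputable def crankTerm (m j : ℕ) : ℤ⟦X⟧ :=
  (1 - X) * X ^ (j + (j + 1) * (m + j)) * partsLeGF j * partsLeGF (m + j)

/-- A partition with `j ≥ 1` ones consists of these, of parts in `2, …, j`, and of parts
greater than `j`. -/
theorem countGF_ones (i : ℕ) {j : ℕ} (hj : 1 ≤ j) :
    countGF (fun s => s.count 1 = j ∧ (s.filter (j < ·)).card = i) =
      X ^ j * ((1 - X) * partsLeGF j * cardGF i j) := by
  have h1 : countGF (fun s => s.count 1 = j ∧ (s.filter (j < ·)).card = i) =
      X ^ j * countGF (fun s => 1 ∉ s ∧ (s.filter (j < ·)).card = i) := by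
    refine countGF_shift j (fun s => s + Multiset.replicate j 1) (Multiset.filter (· ≠ 1)) ?_ ?_
    · rintro s h0 ⟨hs1, hs⟩
      refine ⟨by simp [h0, Multiset.mem_replicate], ⟨?_, ?_⟩, by simp, ?_⟩
      · simp [Multiset.count_eq_zero.2 hs1]
      · rw [Multiset.filter_add, Multiset.filter_eq_nil (s := Multiset.replicate j 1) |>.2, add_zero,
          hs]
        intro a ha
        rw [Multiset.eq_of_mem_replicate ha]
        omega
      · rw [Multiset.filter_add, Multiset.filter_eq_self.2,
          Multiset.filter_eq_nil (s := Multiset.replicate j 1) |>.2, add_zero]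
        · intro a ha
          simp [Multiset.eq_of_mem_replicate ha]
        · exact fun a ha h => hs1 (h ▸ ha)
    · rintro t h0 ⟨ht1, ht⟩
      refine ⟨fun h => h0 (Multiset.mem_of_mem_filter h), ⟨by simp, ?_⟩, ?_⟩
      · rw [Multiset.filter_filter, ← ht]
        congr 1
        exact Multiset.filter_congr fun a _ => ⟨fun h => h.1, fun h => ⟨h, by omega⟩⟩
      · conv_rhs => rw [← Multiset.filter_add_not (· ≠ 1) t]
        congr 1
        rw [← ht1, ← Multiset.filter_eq']
        exact Multiset.filter_congr fun a _ => by simp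
  rw [h1]
  congr 1
  have h2 := countGF_mul (· ≤ j) (fun s => 1 ∉ s) (fun s => s.card = i)
  have h3 : countGF (fun s => (∀ a ∈ s, ¬ a ≤ j) ∧ s.card = i) = cardGF i j :=
    countGF_congr fun s _ => by simp only [not_le]; exact and_comm
  rw [countGF_le_and_one_notMem hj, h3] at h2
  rw [← h2]
  exact countGF_congr fun s _ => by simp [hj]

theorem countGF_no_ones {m : ℕ} (hm : 1 ≤ m) :
    countGF (fun s => s.count 1 = 0 ∧ s.sup = m) + countGF (fun s => m = 1 ∧ s = {1}) =
      crankTerm m 0 := by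
  rw [crankTerm, partsLeGF_zero, add_zero, zero_add, zero_add, one_mul, mul_one]
  obtain rfl | hm2 : m = 1 ∨ 2 ≤ m := by omega
  · rw [countGF_eq_zero, zero_add]
    · have h := countGF_mem (P := fun s => s = {1}) (Q := fun s => s = 0) (a := 1) one_ne_zero
        fun s => ⟨fun h => (Multiset.cons_inj_right 1).1 h, fun h => by simp [h]⟩
      rw [countGF_eq_empty] at h
      have h' : countGF (fun s => 1 = 1 ∧ s = ({1} : Multiset ℕ)) =
          countGF (fun s => s = {1} ∧ 1 ∈ s) :=
        countGF_congr fun s _ => ⟨fun hs => ⟨hs.2, by simp [hs.2]⟩, fun hs => ⟨rfl, hs.1⟩⟩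
      have h2 := one_sub_mul_partsLeGF 0
      rw [partsLeGF_zero] at h2
      rw [h', h]
      linear_combination -X * h2
    · rintro s h0 ⟨h1, hs⟩
      rw [Multiset.count_eq_zero] at h1
      have : s = 0 := Multiset.eq_zero_of_forall_notMem fun a ha => by
        have := Multiset.le_sup ha
        have ha0 : a ≠ 0 := fun h => h0 (h ▸ ha)
        have ha1 : a ≠ 1 := fun h => h1 (h ▸ ha)
        omega
      simp [this] at hs
  · rw [countGF_eq_zero (P := fun s => m = 1 ∧ s = {1}) fun s _ h => by omega, add_zero]
    have h := countGF_mem (P := fun s => (∀ a ∈ s, a ≤ m) ∧ 1 ∉ s)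
      (Q := fun s => (∀ a ∈ s, a ≤ m) ∧ 1 ∉ s) (a := m) (by omega)
      fun s => by simp [show ¬ 1 = m by omega]
    rw [countGF_le_and_one_notMem hm] at h
    rw [mul_comm (1 - X) (X ^ m), mul_assoc, ← h]
    refine countGF_congr fun s _ => ?_
    rw [Multiset.count_eq_zero]
    constructor
    · rintro ⟨h1, hs⟩
      refine ⟨⟨fun a ha => hs ▸ Multiset.le_sup ha, h1⟩, ?_⟩
      by_contra hms
      have : s.sup ≤ m - 1 := Multiset.sup_le.2 fun a ha => by
        have := Multiset.le_sup ha
        have : a ≠ m := fun hh => hms (hh ▸ ha)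
        omega
      omega
    · rintro ⟨⟨hle, h1⟩, hms⟩
      exact ⟨h1, le_antisymm (Multiset.sup_le.2 hle) (Multiset.le_sup hms)⟩

theorem crank_singleton_one : crank {1} = -1 := by
  simp [crank]

/-- The weight of crank `m ≥ 1`, sorted by the number of ones. -/
theorem crankWeight_eq_sum {m J : ℕ} (hm : 1 ≤ m) (s : Multiset ℕ) (hJ : s.count 1 ≤ J) :
    crankWeight m s = (if s.count 1 = 0 ∧ s.sup = m then 1 else 0) +
      (if m = 1 ∧ s = {1} then 1 else 0) +
      ∑ j ∈ range J, if s.count 1 = j + 1 ∧ (s.filter (j + 1 < ·)).card = m + (j + 1)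
        then (1 : ℤ) else 0 := by
  have hsum : ∑ j ∈ range J, (if s.count 1 = j + 1 ∧ (s.filter (j + 1 < ·)).card = m + (j + 1)
      then (1 : ℤ) else 0) = if s.count 1 ≠ 0 ∧ crank s = m then 1 else 0 := by
    rcases Nat.eq_zero_or_pos (s.count 1) with h0 | hpos
    · simp [h0]
    · obtain ⟨w, hw⟩ : ∃ w, s.count 1 = w + 1 := ⟨s.count 1 - 1, by omega⟩
      rw [Finset.sum_eq_single w]
      · have : crank s = m ↔ (s.filter (w + 1 < ·)).card = m + (w + 1) := by
          rw [crank, if_neg (by omega), hw]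
          omega
        simp [hw, this]
      · intro b _ hb
        rw [if_neg]
        omega
      · intro h
        rw [Finset.mem_range] at h
        omega
  rw [hsum, crankWeight]
  by_cases h1 : s = {1}
  · subst h1
    rw [crank_singleton_one]
    simp
    omega
  · by_cases h0 : s.count 1 = 0
    · simp [h1, h0, crank]
    · simp [h1, h0]

/-- The generating function of the partitions by size with crank `m`, with the usual convention
for the partition `(1)`. -/
noncomputable def crankGF (m : ℕ) : ℤ⟦X⟧ := weightGF (crankWeight m)

theorem coeff_crankGF {m n J : ℕ} (hm : 1 ≤ m) (hJ : n < J) :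
    coeff n (crankGF m) = coeff n (∑ j ∈ range J, crankTerm m j) := by
  classical
  obtain ⟨J, rfl⟩ : ∃ K, J = K + 1 := ⟨J - 1, by omega⟩
  have hterm : ∀ j, crankTerm m (j + 1) = countGF (fun s => s.count 1 = j + 1 ∧
      (s.filter (j + 1 < ·)).card = m + (j + 1)) := fun j => by
    rw [countGF_ones _ (by omega), cardGF_eq, crankTerm, pow_add]
    ring
  rw [Finset.sum_range_succ', ← countGF_no_ones hm, add_comm]
  simp only [hterm, map_add, map_sum]
  simp only [crankGF, countGF, coeff_weightGF]
  rw [Finset.sum_comm, ← Finset.sum_add_distrib, ← Finset.sum_add_distrib]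
  refine Finset.sum_congr rfl fun s hs => ?_
  rw [mem_partsFinset] at hs
  have hcount : s.count 1 ≤ n := by
    have h1 := Multiset.card_nsmul_le_sum (s := s) (a := 1)
      fun a ha => Nat.pos_of_ne_zero fun h => hs.1 (h ▸ ha)
    rw [smul_eq_mul, mul_one, hs.2] at h1
    exact (Multiset.count_le_card 1 s).trans h1
  rw [crankWeight_eq_sum hm s (J := J) (by omega)]
  congr!

/-- The three-term recurrence holds term by term, once the index of the last sum is shifted by
one. -/
theorem X_mul_sum_crankTerm (m J : ℕ) :
    X * ∑ j ∈ range (J + 1), crankTerm m j =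
      (1 - X ^ (m + 1)) * ∑ j ∈ range (J + 1), crankTerm (m + 1) j +
        X ^ (m + 2) * ∑ j ∈ range J, crankTerm (m + 2) j := by
  induction J with
  | zero =>
    have h := one_sub_mul_partsLeGF m
    simp only [Finset.sum_range_succ, Finset.sum_range_zero, crankTerm, zero_add, add_zero,
      mul_zero, ← h]
    ring
  | succ J ih =>
    rw [Finset.sum_range_succ, Finset.sum_range_succ (fun j => crankTerm (m + 1) j),
      Finset.sum_range_succ (fun j => crankTerm (m + 2) j)]
    have h1 := one_sub_mul_partsLeGF J
    have h2 := one_sub_mul_partsLeGF (m + (J + 1))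
    have key : X * crankTerm m (J + 1) =
        (1 - X ^ (m + 1)) * crankTerm (m + 1) (J + 1) + X ^ (m + 2) * crankTerm (m + 2) J := by
      simp only [crankTerm, show m + 1 + (J + 1) = m + (J + 1) + 1 by omega,
        show m + 2 + J = m + (J + 1) + 1 by omega, ← h1, ← h2]
      ring
    linear_combination ih + key

theorem crankGF_recurrence {m : ℕ} (hm : 1 ≤ m) :
    X * crankGF m = (1 - X ^ (m + 1)) * crankGF (m + 1) + X ^ (m + 2) * crankGF (m + 2) := by
  have hdvd : ∀ r J, 1 ≤ r → (X : ℤ⟦X⟧) ^ J ∣ crankGF r - ∑ j ∈ range J, crankTerm r j := by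
    intro r J hr
    rw [X_pow_dvd_iff]
    intro n hn
    rw [map_sub, coeff_crankGF hr hn, sub_self]
  rw [← sub_eq_zero]
  ext n
  rw [map_zero]
  have h : (X : ℤ⟦X⟧) ^ (n + 1) ∣ X * crankGF m -
      ((1 - X ^ (m + 1)) * crankGF (m + 1) + X ^ (m + 2) * crankGF (m + 2)) := by
    have h0 := hdvd m (n + 2) hm
    have h1 := hdvd (m + 1) (n + 2) (by omega)
    have h2 := hdvd (m + 2) (n + 1) (by omega)
    have hpow : (X : ℤ⟦X⟧) ^ (n + 1) ∣ X ^ (n + 2) := pow_dvd_pow _ (by omega)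
    have := dvd_sub (dvd_sub ((hpow.trans h0).mul_left X)
      ((hpow.trans h1).mul_left (1 - X ^ (m + 1)))) (h2.mul_left (X ^ (m + 2)))
    have hs := X_mul_sum_crankTerm m (n + 1)
    convert this using 1
    linear_combination hs
  exact X_pow_dvd_iff.1 h n (by omega)

/-! ### Partial theta series -/

/-- The sum `m + (m + 1) + ⋯ + (m + i)` of `i + 1` consecutive integers. -/
def runSum (m i : ℕ) : ℕ := ∑ t ∈ range (i + 1), (m + t)

theorem runSum_succ (m i : ℕ) : runSum m (i + 1) = m + runSum (m + 1) i := by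
  rw [runSum, Finset.sum_range_succ', add_comm, runSum, add_zero]
  exact congrArg _ (Finset.sum_congr rfl fun t _ => by ring)

theorem two_mul_runSum (m i : ℕ) : 2 * runSum m i = (i + 1) * (2 * m + i) := by
  induction i with
  | zero => simp [runSum]
  | succ i ih =>
    rw [runSum, Finset.sum_range_succ, mul_add, ← runSum, ih]
    ring

theorem lt_runSum {m : ℕ} (hm : 1 ≤ m) (i : ℕ) : i < runSum m i := by
  have := two_mul_runSum m i
  nlinarith

theorem le_runSum (m i : ℕ) : m ≤ runSum m i := by
  have := two_mul_runSum m i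
  nlinarith

/-- The partial theta series `∑ (-1) ^ i X ^ (m + (m + 1) + ⋯ + (m + i))`, for `m ≥ 1`. -/
noncomputable def runTheta (m : ℕ) : ℤ⟦X⟧ :=
  PowerSeries.mk fun N => ∑ i ∈ range N, if runSum m i = N then (-1) ^ i else 0

theorem coeff_runTheta {m N K : ℕ} (hm : 1 ≤ m) (hK : N ≤ K) :
    coeff N (runTheta m) = ∑ i ∈ range K, if runSum m i = N then (-1) ^ i else 0 := by
  rw [runTheta, coeff_mk]
  refine Finset.sum_subset (Finset.range_mono hK) fun i _ hi => if_neg fun h => ?_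
  rw [Finset.mem_range] at hi
  have := lt_runSum hm i
  omega

theorem runTheta_eq {m : ℕ} (hm : 1 ≤ m) : runTheta m = X ^ m * (1 - runTheta (m + 1)) := by
  ext N
  rw [coeff_runTheta hm N.le_succ, coeff_X_pow_mul']
  split_ifs with h
  · obtain ⟨r, rfl⟩ := Nat.exists_eq_add_of_le h
    rw [Finset.sum_range_succ', add_tsub_cancel_left, map_sub,
      coeff_runTheta (K := m + r) (by omega) (by omega), coeff_one, sub_eq_neg_add,
      ← Finset.sum_neg_distrib]
    congr 1
    · refine Finset.sum_congr rfl fun i _ => ?_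
      simp only [runSum_succ, add_right_inj]
      split_ifs <;> ring
    · simp [runSum]
  · exact Finset.sum_eq_zero fun i _ => if_neg fun hi => h ((le_runSum m i).trans hi.le)

/-- The generating function of all partitions. -/
noncomputable def partitionGF : ℤ⟦X⟧ := countGF fun _ => True

theorem X_pow_dvd_partitionGF_sub (m : ℕ) : X ^ (m + 1) ∣ partitionGF - partsLeGF m := by
  rw [X_pow_dvd_iff]
  intro n hn
  rw [map_sub, partitionGF, partsLeGF, coeff_countGF, coeff_countGF, Finset.filter_true,
    Finset.filter_true_of_mem, sub_self]
  intro s hs a ha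
  have := Multiset.single_le_sum (fun x _ => Nat.zero_le x) a ha
  rw [(mem_partsFinset.1 hs).2] at this
  omega

theorem X_pow_dvd_crankGF_sub {m : ℕ} (hm : 1 ≤ m) :
    X ^ (2 * m + 1) ∣ crankGF m - (1 - X) * X ^ m * partsLeGF m := by
  have h0 : crankTerm m 0 = (1 - X) * X ^ m * partsLeGF m := by
    simp [crankTerm, partsLeGF_zero]
  have h1 : X ^ (2 * m + 1) ∣ crankGF m - ∑ j ∈ range (2 * m + 1), crankTerm m j := by
    rw [X_pow_dvd_iff]
    intro n hn
    rw [map_sub, coeff_crankGF hm hn, sub_self]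
  have h2 : X ^ (2 * m + 1) ∣ ∑ j ∈ range (2 * m), crankTerm m (j + 1) := by
    refine Finset.dvd_sum fun j _ => ?_
    rw [crankTerm, mul_assoc, mul_right_comm, mul_comm]
    exact ((pow_dvd_pow _ (by nlinarith)).mul_left _)
  rw [Finset.sum_range_succ', h0] at h1
  convert dvd_add h1 h2 using 1
  ring

/-- The partial theta expansion of the generating function of the partitions with crank `m`. Both
sides solve the same three-term recurrence in `m`, and they agree modulo `X ^ (2 * m + 1)`; the
recurrence carries a difference of high order at large `m` down to all smaller `m`. -/
theorem crankGF_eq {m : ℕ} (hm : 1 ≤ m) :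
    crankGF m = partitionGF * (runTheta m - runTheta (m + 1)) := by
  set Δ : ℕ → ℤ⟦X⟧ := fun m => crankGF m - partitionGF * (runTheta m - runTheta (m + 1)) with hΔ
  have hrec : ∀ m, 1 ≤ m →
      X * Δ m = (1 - X ^ (m + 1)) * Δ (m + 1) + X ^ (m + 2) * Δ (m + 2) := by
    intro m hm
    simp only [hΔ]
    have h1 := crankGF_recurrence hm
    have h2 := runTheta_eq hm
    have h3 := runTheta_eq (m := m + 1) (by omega)
    have h4 := runTheta_eq (m := m + 2) (by omega)
    linear_combination h1 - partitionGF * X * h2 + partitionGF * (1 + X) * h3 - partitionGF * h4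
  have hbase : ∀ m, 1 ≤ m → X ^ (2 * m + 1) ∣ Δ m := by
    intro m hm
    have h1 := X_pow_dvd_crankGF_sub hm
    have h2 : X ^ (2 * m + 1) ∣ (1 - X) * X ^ m * (partitionGF - partsLeGF m) := by
      have := mul_dvd_mul_left ((1 - X) * X ^ m) (X_pow_dvd_partitionGF_sub m)
      refine dvd_trans ?_ this
      rw [mul_assoc, ← pow_add, show m + (m + 1) = 2 * m + 1 by ring]
      exact dvd_mul_left _ _
    have h3 := runTheta_eq hm
    have h4 := runTheta_eq (m := m + 1) (by omega)
    have h5 : X ^ (2 * m + 1) ∣ partitionGF * (X ^ m * runTheta (m + 1)) := by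
      rw [h4, ← mul_assoc, ← mul_assoc, mul_assoc partitionGF, ← pow_add,
        show m + (m + 1) = 2 * m + 1 by ring, mul_assoc]
      exact (dvd_mul_right _ _).mul_left _
    have h6 : X ^ (2 * m + 1) ∣ partitionGF * (X ^ (m + 1) * runTheta (m + 2)) := by
      rw [runTheta_eq (m := m + 2) (by omega), ← mul_assoc (X ^ (m + 1)), ← pow_add]
      exact (((pow_dvd_pow _ (by omega)).mul_right _).mul_left _)
    convert dvd_sub (dvd_add (dvd_sub h1 h2) h5) h6 using 1
    simp only [hΔ]
    linear_combination -partitionGF * h3 + partitionGF * h4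
  -- Downward induction on `m`, with `i` measuring the distance to the range where `hbase` applies.
  have hall : ∀ t i m, 1 ≤ m → t ≤ m + 1 + i → X ^ (m + t) ∣ Δ m := by
    intro t i
    induction i using Nat.strong_induction_on with
    | _ i ih =>
      intro m hm ht
      by_cases hi : t ≤ m + 1
      · exact (pow_dvd_pow _ (by omega)).trans (hbase m hm)
      · have h1 := ih (i - 1) (by omega) (m + 1) (by omega) (by omega)
        have h2 := ih (i - 1) (by omega) (m + 2) (by omega) (by omega)
        have h3 : X * X ^ (m + t) ∣ X * Δ m := by
          rw [hrec m hm, ← pow_succ']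
          refine dvd_add (Dvd.dvd.mul_left ?_ _) (Dvd.dvd.mul_left ?_ _)
          · exact (pow_dvd_pow _ (by omega)).trans h1
          · exact (pow_dvd_pow _ (by omega)).trans h2
        exact (mul_dvd_mul_iff_left X_ne_zero).1 h3
  rw [← sub_eq_zero]
  ext n
  exact X_pow_dvd_iff.1 (hall (n + 1) n m hm (by omega)) n (by omega)

/-! ### Runs of consecutive integers -/

/-- The coefficient of `X ^ N` counts the representations of `N` as a sum of a run of consecutive
integers from a given start, with sign `+` for odd and `-` for even length.
Runs of even length `2 * l` starting at `m` correspond to factorizations `N = l * δ` with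
`δ = 2 * m + 2 * l - 1` odd. Moving the powers of two from `l` to `δ` turns this into a
factorization with an odd number of terms, that is, a run of odd length starting no earlier. As the
power of two is the full power in `N`, this is injective. -/
theorem sum_coeff_runTheta_nonneg {a b N : ℕ} (ha : 1 ≤ a) (hb : N < b) :
    0 ≤ ∑ m ∈ Ico a b, coeff N (runTheta m) := by
  set S := {x ∈ Ico a b ×ˢ range N | runSum x.1 x.2 = N} with hS
  have hsum : ∑ m ∈ Ico a b, coeff N (runTheta m) = ∑ x ∈ S, (-1 : ℤ) ^ x.2 := by
    rw [hS, Finset.sum_filter, Finset.sum_product]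
    refine Finset.sum_congr rfl fun m hm => ?_
    rw [coeff_runTheta (ha.trans (Finset.mem_Ico.1 hm).1) le_rfl]
  have hmem : ∀ m i, (m, i) ∈ S ↔ a ≤ m ∧ runSum m i = N := by
    intro m i
    simp only [hS, Finset.mem_filter, Finset.mem_product, Finset.mem_Ico, Finset.mem_range]
    refine ⟨fun h => ⟨h.1.1.1, h.2⟩, fun h => ⟨⟨⟨h.1, ?_⟩, ?_⟩, h.2⟩⟩
    · have := le_runSum m i
      omega
    · have := lt_runSum (ha.trans h.1) i
      omega
  have hcard : #{x ∈ S | ¬ Even x.2} ≤ #{x ∈ S | Even x.2} := by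
    -- `l x` is half the length of the run, `o x` the odd part of `l x`.
    let l : ℕ × ℕ → ℕ := fun x => (x.2 + 1) / 2
    let v : ℕ × ℕ → ℕ := fun x => (l x).factorization 2
    let o : ℕ × ℕ → ℕ := fun x => l x / 2 ^ v x
    let δ : ℕ × ℕ → ℕ := fun x => 2 * x.1 + x.2
    have hprop : ∀ x ∈ {x ∈ S | ¬ Even x.2}, a ≤ x.1 ∧ x.2 + 1 = 2 * l x ∧ l x * δ x = N ∧
        2 ^ v x * o x = l x ∧ Odd (o x) ∧ Odd (δ x) := by
      rintro ⟨m, i⟩ hx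
      rw [Finset.mem_filter, hmem, Nat.not_even_iff_odd] at hx
      obtain ⟨⟨hm, hN⟩, hi⟩ := hx
      obtain ⟨r, rfl : i = 2 * r + 1⟩ := hi
      have hl : l (m, 2 * r + 1) = r + 1 := by simp only [l]; omega
      have h2 := two_mul_runSum m (2 * r + 1)
      refine ⟨hm, by simp only [hl]; ring, ?_, Nat.ordProj_mul_ordCompl_eq_self _ 2, ?_, ?_⟩
      · rw [hl]
        simp only [δ]
        rw [hN] at h2
        linarith
      · rw [← Nat.not_even_iff_odd, even_iff_two_dvd]
        exact Nat.not_dvd_ordCompl Nat.prime_two (by omega)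
      · exact ⟨m + r, by simp only [δ]; ring⟩
    -- The new run has `o x` terms, with middle term `2 ^ v x * δ x`.
    refine Finset.card_le_card_of_injOn
      (fun x => (2 ^ v x * δ x - (o x - 1) / 2, o x - 1)) ?_ ?_
    · intro x hx
      obtain ⟨hm, hl, hN, hvo, ho, -⟩ := hprop x hx
      have hv : 1 ≤ 2 ^ v x := Nat.one_le_two_pow
      have hδ : 2 * x.1 + x.2 = δ x := rfl
      rw [Finset.mem_coe, Finset.mem_filter, hmem]
      obtain ⟨q, hq⟩ := ho
      have hol : o x ≤ l x := by nlinarith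
      have hδv : δ x ≤ 2 ^ v x * δ x := Nat.le_mul_of_pos_left _ hv
      have hq1 : o x - 1 = 2 * q := by omega
      have hq2 : 2 * q / 2 = q := by omega
      simp only [hq1, hq2]
      refine ⟨⟨by omega, ?_⟩, even_two_mul q⟩
      have h2 := two_mul_runSum (2 ^ v x * δ x - q) (2 * q)
      rw [show 2 * (2 ^ v x * δ x - q) + 2 * q = 2 * (2 ^ v x * δ x) by omega, ← hq] at h2
      have h3 : o x * (2 * (2 ^ v x * δ x)) = 2 * N := by
        rw [← hN, ← hvo]
        ring
      omega
    · intro x hx y hy hxy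
      obtain ⟨-, hlx, hNx, hvox, hox, hδx⟩ := hprop x hx
      obtain ⟨-, hly, hNy, hvoy, hoy, hδy⟩ := hprop y hy
      simp only [Prod.mk.injEq] at hxy
      have ho : o x = o y := by
        have := hox.pos
        have := hoy.pos
        omega
      -- As `δ z` is odd, the power of two in `l z` is determined by `N`.
      have hfac : ∀ z, l z * δ z = N → Odd (δ z) → l z ≠ 0 →
          v z = N.factorization 2 := by
        intro z hz hodd hl0
        rw [← hz, Nat.factorization_mul hl0 hodd.pos.ne', Finsupp.add_apply,
          Nat.factorization_eq_zero_of_not_dvd (n := δ z), add_zero]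
        rwa [← even_iff_two_dvd, Nat.not_even_iff_odd]
      have hv : v x = v y := by
        rw [hfac x hNx hδx (by omega), hfac y hNy hδy (by omega)]
      have hl : l x = l y := by rw [← hvox, ← hvoy, hv, ho]
      have hδ : δ x = δ y := by
        rw [← hNy, hl] at hNx
        exact Nat.eq_of_mul_eq_mul_left (by omega) hNx
      have h2 : x.2 = y.2 := by omega
      have h1 : x.1 = y.1 := by
        simp only [δ] at hδ
        omega
      exact Prod.ext h1 h2
  rw [hsum, ← Finset.sum_filter_add_sum_filter_not S (fun x => Even x.2),
    Finset.sum_congr rfl fun x hx => (Finset.mem_filter.1 hx).2.neg_one_pow,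
    Finset.sum_congr (s₁ := {x ∈ S | ¬ Even x.2}) rfl
      fun x hx => (Nat.not_even_iff_odd.1 (Finset.mem_filter.1 hx).2).neg_one_pow]
  simp only [Finset.sum_const, nsmul_eq_mul]
  have : (#{x ∈ S | ¬ Even x.2} : ℤ) ≤ #{x ∈ S | Even x.2} := by exact_mod_cast hcard
  linarith

/-! ### Positivity of the moment coefficients -/

/-- A sum with nonnegative tails stays nonnegative after multiplication by monotone nonnegative
coefficients, in the quantitative form that an induction on the lower limit needs. -/
theorem mul_sum_Ico_le_sum_Ico_mul {c h : ℕ → ℤ} (hc : Monotone c) {K : ℕ}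
    (hh : ∀ M, 0 ≤ ∑ m ∈ Ico M K, h m) (M : ℕ) :
    c M * ∑ m ∈ Ico M K, h m ≤ ∑ m ∈ Ico M K, c m * h m := by
  rcases le_total K M with hKM | hMK
  · simp [Finset.Ico_eq_empty_of_le hKM]
  · refine Nat.decreasingInduction
      (motive := fun M _ => c M * ∑ m ∈ Ico M K, h m ≤ ∑ m ∈ Ico M K, c m * h m) ?_ ?_ hMK
    · intro M hM ih
      rw [Finset.sum_eq_sum_Ico_succ_bot hM, Finset.sum_eq_sum_Ico_succ_bot hM]
      have := mul_le_mul_of_nonneg_right (hc M.le_succ) (hh (M + 1))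
      linarith
    · simp

theorem monotone_pow_succ_sub_pow (k : ℕ) :
    Monotone fun m : ℕ => ((m : ℤ) + 1) ^ k - (m : ℤ) ^ k := by
  induction k with
  | zero => simpa using monotone_const
  | succ k ih =>
    refine monotone_nat_of_le_succ fun m => ?_
    have h1 := ih m.le_succ
    have h2 : (m : ℤ) ^ k ≤ ((m : ℤ) + 1) ^ k := by gcongr; omega
    simp only [Nat.succ_eq_add_one, Nat.cast_add, Nat.cast_one] at h1 ⊢
    have h3 := mul_le_mul_of_nonneg_left h1 (by positivity : (0 : ℤ) ≤ m + 1)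
    simp only [pow_succ]
    nlinarith

theorem sum_range_mul_sub (f g : ℕ → ℤ) (hf : f 0 = 0) (K : ℕ) :
    ∑ m ∈ range K, f (m + 1) * (g (m + 1) - g (m + 2)) =
      ∑ m ∈ range K, (f (m + 1) - f m) * g (m + 1) - f K * g (K + 1) := by
  induction K with
  | zero => simp [hf]
  | succ K ih =>
    rw [Finset.sum_range_succ, Finset.sum_range_succ, ih]
    ring

/-- The quotient by the generating function of all partitions of the generating function of the
`k`th positive crank moments, truncated to cranks at most `K`. -/
noncomputable def momentQuotient (k K : ℕ) : ℤ⟦X⟧ :=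
  ∑ m ∈ Icc 1 K, (m : ℤ⟦X⟧) ^ k * (runTheta m - runTheta (m + 1))

theorem coeff_momentQuotient (k K N : ℕ) :
    coeff N (momentQuotient k K) =
      ∑ m ∈ Icc 1 K, (m : ℤ) ^ k * (coeff N (runTheta m) - coeff N (runTheta (m + 1))) := by
  rw [momentQuotient, map_sum]
  refine Finset.sum_congr rfl fun m _ => ?_
  rw [show ((m : ℤ⟦X⟧) ^ k) = C ((m : ℤ) ^ k) by simp, coeff_C_mul, map_sub]

theorem coeff_runTheta_eq_zero {m N : ℕ} (h : N < m) : coeff N (runTheta m) = 0 := by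
  rw [runTheta, coeff_mk]
  refine Finset.sum_eq_zero fun i _ => if_neg fun hi => ?_
  have := le_runSum m i
  omega

/-- Two summations by parts reduce the claim to the convexity of `m ^ k` and to the positivity of
the tails `∑ m ≥ M, runTheta m`. -/
theorem coeff_momentQuotient_nonneg {k K N : ℕ} (hk : 1 ≤ k) (hN : N ≤ K) :
    0 ≤ coeff N (momentQuotient k K) := by
  rw [coeff_momentQuotient, ← Finset.Ico_add_one_right_eq_Icc, Finset.sum_Ico_eq_sum_range,
    add_tsub_cancel_right]
  have h := sum_range_mul_sub (fun m => (m : ℤ) ^ k) (fun m => coeff N (runTheta m))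
    (by simp; omega) K
  simp only [coeff_runTheta_eq_zero (show N < K + 1 by omega), mul_zero, sub_zero] at h
  have h2 := mul_sum_Ico_le_sum_Ico_mul (monotone_pow_succ_sub_pow k)
    (h := fun m => coeff N (runTheta (m + 1))) (K := K) ?_ 0
  · have h3 : (0 : ℤ) ^ k = 0 := zero_pow (by omega)
    have h4 : 0 ≤ ∑ m ∈ Ico 0 K, coeff N (runTheta (m + 1)) := by
      rw [Finset.sum_Ico_add' (fun m => coeff N (runTheta m))]
      exact sum_coeff_runTheta_nonneg (by omega) (by omega)
    simp only [Nat.cast_zero, zero_add, one_pow, h3, sub_zero, one_mul] at h2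
    rw [Nat.Ico_zero_eq_range] at h2 h4
    refine (h4.trans h2).trans (le_of_eq ?_)
    simp only [Nat.cast_add, Nat.cast_one] at h
    rw [← h]
    refine Finset.sum_congr rfl fun m _ => ?_
    rw [add_comm 1 m]
    push_cast
    rfl
  · intro M
    rw [Finset.sum_Ico_add' (fun m => coeff N (runTheta m))]
    exact sum_coeff_runTheta_nonneg (by omega) (by omega)

theorem coeff_zero_momentQuotient (k K : ℕ) : coeff 0 (momentQuotient k K) = 0 := by
  rw [coeff_momentQuotient]
  refine Finset.sum_eq_zero fun m hm => ?_
  rw [Finset.mem_Icc] at hm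
  rw [coeff_runTheta_eq_zero (by omega), coeff_runTheta_eq_zero (by omega), sub_zero, mul_zero]

theorem coeff_one_momentQuotient (k : ℕ) {K : ℕ} (hK : 1 ≤ K) :
    coeff 1 (momentQuotient k K) = 1 := by
  rw [coeff_momentQuotient, Finset.sum_eq_single 1]
  · rw [coeff_runTheta_eq_zero (m := 1 + 1) (by omega), runTheta, coeff_mk]
    simp [runSum]
  · intro m hm hm1
    rw [Finset.mem_Icc] at hm
    rw [coeff_runTheta_eq_zero (by omega), coeff_runTheta_eq_zero (by omega), sub_zero, mul_zero]
  · simp only [Finset.mem_Icc]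
    omega

theorem weightGF_moment (k K : ℕ) :
    weightGF (fun s => ∑ m ∈ Icc 1 K, (m : ℤ) ^ k * crankWeight m s) =
      partitionGF * momentQuotient k K := by
  have h : weightGF (fun s => ∑ m ∈ Icc 1 K, (m : ℤ) ^ k * crankWeight m s) =
      ∑ m ∈ Icc 1 K, (m : ℤ⟦X⟧) ^ k * crankGF m := by
    ext n
    rw [coeff_weightGF, Finset.sum_comm, map_sum]
    refine Finset.sum_congr rfl fun m _ => ?_
    rw [show ((m : ℤ⟦X⟧) ^ k) = C ((m : ℤ) ^ k) by simp, coeff_C_mul, crankGF, coeff_weightGF,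
      Finset.mul_sum]
  rw [h, momentQuotient, Finset.mul_sum]
  refine Finset.sum_congr rfl fun m hm => ?_
  rw [crankGF_eq (Finset.mem_Icc.1 hm).1]
  ring

/-! ### Overpartitions and residual partitions -/

/-- An overpartition consists of a partition into distinct parts (the overlined ones) and an
arbitrary partition (the non-overlined parts). -/
theorem sum_nonOverlined (f : Multiset ℕ → ℤ) (n : ℕ) :
    ∑ l : Overpartition n, f l.nonOverlined =
      coeff n (countGF Multiset.Nodup * weightGF f) := by
  classical
  rw [coeff_mul]
  simp only [countGF, coeff_weightGF, Finset.sum_mul_sum, ← Finset.sum_product', ite_mul, one_mul,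
    zero_mul]
  simp only [← Finset.sum_filter]
  rw [Finset.sum_sigma']
  have hpos : ∀ l : Overpartition n, 0 ∉ l.toPartition.parts := fun l h =>
    (l.toPartition.parts_pos h).ne rfl
  have hle : ∀ l : Overpartition n, l.overlined.val ≤ l.toPartition.parts := fun l =>
    (Multiset.le_iff_subset l.overlined.nodup).2 fun a ha =>
      Multiset.mem_toFinset.1 (l.overlined_subset ha)
  have hadd : ∀ l : Overpartition n, l.overlined.val + l.nonOverlined = l.toPartition.parts :=
    fun l => add_tsub_cancel_of_le (hle l)
  refine Finset.sum_bij (fun l _ => ⟨(l.overlined.val.sum, l.nonOverlined.sum),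
    (l.overlined.val, l.nonOverlined)⟩) ?_ ?_ ?_ ?_
  · intro l _
    have h := congrArg Multiset.sum (hadd l)
    rw [Multiset.sum_add, l.toPartition.parts_sum] at h
    simp only [Finset.mem_sigma, Finset.mem_product, Finset.mem_filter, mem_partsFinset]
    refine ⟨mem_antidiagonal.2 h, ⟨⟨fun h0 => hpos l ?_, trivial⟩, fun h0 => hpos l ?_, trivial⟩,
      l.overlined.nodup⟩
    · exact Multiset.mem_of_le (hle l) h0
    · exact Multiset.mem_of_le (Multiset.sub_le_self _ _) h0
  · intro l _ l' _ h
    simp only [Sigma.mk.injEq, heq_eq_eq, Prod.mk.injEq] at h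
    refine Overpartition.ext (Nat.Partition.ext ?_) (Finset.val_injective h.2.1)
    rw [← hadd l, ← hadd l', h.2.1, h.2.2]
  · rintro ⟨⟨a, b⟩, ⟨s, t⟩⟩ hx
    simp only [Finset.mem_sigma, Finset.mem_product, Finset.mem_filter, mem_partsFinset] at hx
    obtain ⟨hab, ⟨⟨hs0, rfl⟩, ht0, rfl⟩, hs⟩ := hx
    refine ⟨⟨⟨s + t, fun {i} hi => Nat.pos_of_ne_zero fun h => ?_, ?_⟩, ⟨s, hs⟩, ?_⟩,
      Finset.mem_univ _, ?_⟩
    · subst h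
      exact (Multiset.mem_add.1 hi).elim hs0 ht0
    · rw [Multiset.sum_add, mem_antidiagonal.1 hab]
    · intro a ha
      exact Multiset.mem_toFinset.2 (Multiset.mem_add.2 (Or.inl ha))
    · simp [Overpartition.nonOverlined]
  · intro l _
    rfl

/-- Dividing all parts by `d` identifies the partitions into multiples of `d` with all
partitions. -/
theorem weightGF_dvd {d : ℕ} (hd : d ≠ 0) (w : Multiset ℕ → ℤ) :
    weightGF (fun s => if ∀ a ∈ s, d ∣ a then w (s.map (· / d)) else 0) =
      (weightGF w).expand d hd := by
  have hdiv : ∀ s : Multiset ℕ, (∀ a ∈ s, d ∣ a) → (s.map (· / d)).map (d * ·) = s := by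
    intro s hs
    rw [Multiset.map_map]
    conv_rhs => rw [← Multiset.map_id s]
    exact Multiset.map_congr rfl fun a ha => Nat.mul_div_cancel' (hs a ha)
  have hmul : ∀ s : Multiset ℕ, (s.map (d * ·)).map (· / d) = s := by
    intro s
    rw [Multiset.map_map]
    conv_rhs => rw [← Multiset.map_id s]
    exact Multiset.map_congr rfl fun a _ => Nat.mul_div_cancel_left a (Nat.pos_of_ne_zero hd)
  have hsum : ∀ s : Multiset ℕ, (∀ a ∈ s, d ∣ a) → s.sum = d * (s.map (· / d)).sum := by
    intro s hs
    conv_lhs => rw [← hdiv s hs, Multiset.sum_map_mul_left, Multiset.map_id']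
  ext n
  rw [coeff_expand, coeff_weightGF, ← Finset.sum_filter]
  split_ifs with hn
  · obtain ⟨r, rfl⟩ := hn
    rw [Nat.mul_div_cancel_left _ (Nat.pos_of_ne_zero hd), coeff_weightGF]
    refine Finset.sum_nbij' (Multiset.map (· / d)) (Multiset.map (d * ·)) ?_ ?_ ?_ ?_ ?_
    · intro s hs
      rw [Finset.mem_filter, mem_partsFinset] at hs
      rw [mem_partsFinset]
      refine ⟨fun h => ?_, ?_⟩
      · obtain ⟨a, ha, ha0⟩ := Multiset.mem_map.1 h
        have := Nat.mul_div_cancel' (hs.2 a ha)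
        rw [ha0, mul_zero] at this
        exact hs.1.1 (this ▸ ha)
      · have := hsum s hs.2
        rw [hs.1.2] at this
        exact (Nat.eq_of_mul_eq_mul_left (Nat.pos_of_ne_zero hd) this).symm
    · intro s hs
      rw [mem_partsFinset] at hs
      rw [Finset.mem_filter, mem_partsFinset]
      refine ⟨⟨fun h => ?_, by rw [Multiset.sum_map_mul_left, Multiset.map_id', hs.2]⟩, ?_⟩
      · obtain ⟨a, ha, ha0⟩ := Multiset.mem_map.1 h
        have : a = 0 := (Nat.mul_eq_zero.1 ha0).resolve_left hd
        exact hs.1 (this ▸ ha)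
      · intro a ha
        obtain ⟨b, -, rfl⟩ := Multiset.mem_map.1 ha
        exact dvd_mul_right d b
    · exact fun s hs => hdiv s (Finset.mem_filter.1 hs).2
    · exact fun s _ => hmul s
    · exact fun s _ => rfl
  · refine Finset.sum_eq_zero fun s hs => ?_
    rw [Finset.mem_filter, mem_partsFinset] at hs
    exact absurd (hs.1.2 ▸ hsum s hs.2 ▸ dvd_mul_right d _) hn

/-- The generating function of the overpartitions none of whose non-overlined parts is divisible
by `d`. -/
noncomputable def regularGF (d : ℕ) : ℤ⟦X⟧ :=
  countGF Multiset.Nodup * countGF fun s => ∀ a ∈ s, ¬ d ∣ a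

/-- The non-overlined parts divisible by `d`, divided by `d`, form an arbitrary partition,
independent of all the other parts. -/
theorem sum_residual {d : ℕ} (hd : d ≠ 0) (w : Multiset ℕ → ℤ) (n : ℕ) :
    ∑ l : Overpartition n, w (l.residual d) =
      coeff n (regularGF d * (weightGF w).expand d hd) := by
  have h := weightGF_mul (d ∣ ·) (fun s => w (s.map (· / d))) (fun _ => 1)
  simp only [mul_one] at h
  rw [weightGF_dvd hd] at h
  have h2 : weightGF (fun s => if ∀ a ∈ s, ¬ d ∣ a then 1 else 0) =
      countGF fun s => ∀ a ∈ s, ¬ d ∣ a := by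
    rw [countGF]
    congr!
  rw [h2] at h
  have h3 := sum_nonOverlined (fun s => w ((s.filter (d ∣ ·)).map (· / d))) n
  rw [h] at h3
  refine h3.trans ?_
  rw [regularGF]
  congr 1
  ring

/-- The generating function of all overpartitions. -/
noncomputable def overpartitionGF : ℤ⟦X⟧ := countGF Multiset.Nodup * partitionGF

theorem partitionGF_eq : partitionGF = weightGF fun _ => 1 :=
  weightGF_congr fun _ _ => if_pos trivial

theorem coeff_overpartitionGF (n : ℕ) :
    coeff n overpartitionGF = Fintype.card (Overpartition n) := by
  rw [overpartitionGF, partitionGF_eq, ← sum_nonOverlined]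
  simp

theorem overpartitionGF_eq {d : ℕ} (hd : d ≠ 0) :
    overpartitionGF = regularGF d * partitionGF.expand d hd := by
  ext n
  rw [coeff_overpartitionGF, partitionGF_eq, ← sum_residual]
  simp

theorem card_overpartition_lt (n : ℕ) :
    Fintype.card (Overpartition n) < Fintype.card (Overpartition (n + 1)) := by
  -- Insert a non-overlined part `1`; the single overlined part `n + 1` is not attained.
  let f : Overpartition n → Overpartition (n + 1) := fun l =>
    ⟨⟨1 ::ₘ l.toPartition.parts, fun {i} hi => by
        rcases Multiset.mem_cons.1 hi with rfl | h
        exacts [one_pos, l.toPartition.parts_pos h],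
      by rw [Multiset.sum_cons, l.toPartition.parts_sum, add_comm]⟩, l.overlined,
      l.overlined_subset.trans (Multiset.toFinset_subset.2 (Multiset.subset_cons _ _))⟩
  let l₀ : Overpartition (n + 1) := ⟨⟨{n + 1}, fun {i} hi => by simp at hi; omega, by simp⟩,
    {n + 1}, by simp⟩
  refine Fintype.card_lt_of_injective_of_notMem f (b := l₀) ?_ ?_
  · intro l l' h
    have h1 : 1 ::ₘ l.toPartition.parts = 1 ::ₘ l'.toPartition.parts :=
      congrArg (fun x => x.toPartition.parts) h
    have h2 : l.overlined = l'.overlined := congrArg (fun x => x.overlined) h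
    exact Overpartition.ext (Nat.Partition.ext ((Multiset.cons_inj_right 1).1 h1)) h2
  · rintro ⟨l, hl⟩
    have h1 : l.overlined = {n + 1} := congrArg Overpartition.overlined hl
    have h2 : n + 1 ∈ l.toPartition.parts :=
      Multiset.mem_toFinset.1 (l.overlined_subset (h1 ▸ Finset.mem_singleton_self _))
    have := l.toPartition.le_of_mem_parts h2
    omega

/-! ### Monotonicity of the moments -/

/-- The number of overpartitions of `n - i`, which is `0` if `n < i`. -/
def overpartitionCount (n i : ℕ) : ℤ := if i ≤ n then Fintype.card (Overpartition (n - i)) else 0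

theorem overpartitionCount_nonneg (n i : ℕ) : 0 ≤ overpartitionCount n i := by
  rw [overpartitionCount]
  split_ifs <;> positivity

theorem overpartitionCount_pos {n i : ℕ} (h : i ≤ n) : 0 < overpartitionCount n i := by
  rw [overpartitionCount, if_pos h, Nat.cast_pos]
  rcases Nat.eq_zero_or_pos (n - i) with h0 | h0
  · rw [h0]
    exact Fintype.card_pos_iff.2 ⟨⟨⟨0, by simp, rfl⟩, ∅, by simp⟩⟩
  · obtain ⟨r, hr⟩ : ∃ r, n - i = r + 1 := ⟨n - i - 1, by omega⟩
    rw [hr]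
    exact (Nat.zero_le _).trans_lt (card_overpartition_lt r)

theorem overpartitionCount_succ_lt {n i : ℕ} (h : i ≤ n) :
    overpartitionCount n (i + 1) < overpartitionCount n i := by
  by_cases hi : i + 1 ≤ n
  · rw [overpartitionCount, overpartitionCount, if_pos h, if_pos hi,
      show n - i = n - (i + 1) + 1 by omega]
    exact_mod_cast card_overpartition_lt _
  · conv_lhs => rw [overpartitionCount, if_neg hi]
    exact overpartitionCount_pos h

theorem overpartitionCount_antitone (n : ℕ) : Antitone (overpartitionCount n) := by
  refine antitone_nat_of_succ_le fun i => ?_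
  by_cases hi : i ≤ n
  · exact (overpartitionCount_succ_lt hi).le
  · rw [overpartitionCount, if_neg (by omega)]
    exact overpartitionCount_nonneg n i

/-- The moments as combinations of overpartition numbers, with coefficients independent of `d`. -/
theorem posMoment_eq_sum {d : ℕ} (hd : d ≠ 0) (k n : ℕ) :
    posMoment d k n =
      ∑ N ∈ range (n + 1), coeff N (momentQuotient k n) * overpartitionCount n (d * N) := by
  have h1 : posMoment d k n = coeff n (overpartitionGF * (momentQuotient k n).expand d hd) := by
    have h := sum_residual hd (fun s => ∑ m ∈ Icc 1 n, (m : ℤ) ^ k * crankWeight m s) n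
    rw [weightGF_moment, map_mul (PowerSeries.expand d hd), ← mul_assoc, ← overpartitionGF_eq hd] at h
    rw [← h, Finset.sum_comm]
    simp only [posMoment, residualCrankCount, Finset.mul_sum]
  rw [h1, mul_comm, coeff_mul, Finset.Nat.sum_antidiagonal_eq_sum_range_succ
    (fun i j => coeff i ((momentQuotient k n).expand d hd) * coeff j overpartitionGF)]
  have hd' := Nat.pos_of_ne_zero hd
  have h2 : ∑ N ∈ range (n + 1), coeff N (momentQuotient k n) * overpartitionCount n (d * N) =
      ∑ N ∈ range (n + 1) with d * N ≤ n,
        coeff (d * N) ((momentQuotient k n).expand d hd) * coeff (n - d * N) overpartitionGF := by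
    rw [Finset.sum_filter]
    refine Finset.sum_congr rfl fun N _ => ?_
    rw [coeff_expand_mul, overpartitionCount, coeff_overpartitionGF]
    split_ifs <;> simp
  rw [h2]
  refine (Finset.sum_of_injOn (d * ·) ?_ ?_ ?_ ?_).symm
  · exact fun a _ b _ h => Nat.eq_of_mul_eq_mul_left hd' h
  · intro N hN
    simp only [Finset.coe_filter, Finset.mem_range, Set.mem_ofPred_eq, Finset.mem_coe] at hN ⊢
    omega
  · intro i hi hni
    rw [coeff_expand, if_neg, zero_mul]
    rintro ⟨N, rfl⟩
    refine hni ⟨N, ?_, rfl⟩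
    simp only [Finset.coe_filter, Finset.mem_range, Set.mem_ofPred_eq] at hi ⊢
    have : N ≤ d * N := Nat.le_mul_of_pos_left N hd'
    omega
  · exact fun N _ => rfl

theorem posMoment_eq_zero_of_lt {d k n : ℕ} (hd : 1 ≤ d) (h : n < d) : posMoment d k n = 0 := by
  rw [posMoment_eq_sum (by omega)]
  refine Finset.sum_eq_zero fun N _ => ?_
  rcases Nat.eq_zero_or_pos N with rfl | hN
  · rw [coeff_zero_momentQuotient, zero_mul]
  · rw [overpartitionCount, if_neg, mul_zero]
    have : d ≤ d * N := Nat.le_mul_of_pos_right d hN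
    omega

theorem posMoment_nonneg {d k n : ℕ} (hd : 1 ≤ d) (hk : 1 ≤ k) : 0 ≤ posMoment d k n := by
  rw [posMoment_eq_sum (by omega)]
  refine Finset.sum_nonneg fun N hN => mul_nonneg ?_ (overpartitionCount_nonneg _ _)
  exact coeff_momentQuotient_nonneg hk (by rw [Finset.mem_range] at hN; omega)

theorem posMoment_succ_lt {d k n : ℕ} (hd : 1 ≤ d) (hk : 1 ≤ k) (h : d ≤ n) :
    posMoment (d + 1) k n < posMoment d k n := by
  rw [posMoment_eq_sum (by omega), posMoment_eq_sum (by omega)]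
  refine Finset.sum_lt_sum (fun N hN => mul_le_mul_of_nonneg_left ?_ ?_) ⟨1, ?_, ?_⟩
  · exact overpartitionCount_antitone n (Nat.mul_le_mul_right N d.le_succ)
  · exact coeff_momentQuotient_nonneg hk (by rw [Finset.mem_range] at hN; omega)
  · rw [Finset.mem_range]
    omega
  · rw [coeff_one_momentQuotient k (by omega), one_mul, one_mul, mul_one, mul_one]
    exact overpartitionCount_succ_lt h

theorem theorem1 (d k n : ℕ) (hd : 1 ≤ d) (hk : 1 ≤ k) :
    posMoment (d + 1) k n ≤ posMoment d k n ∧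
    (posMoment (d + 1) k n = posMoment d k n ↔ posMoment d k n = 0) ∧
    (posMoment d k n = 0 ↔ n < d) := by
  rcases lt_or_ge n d with h | h
  · have h1 := posMoment_eq_zero_of_lt (k := k) hd h
    have h2 := posMoment_eq_zero_of_lt (d := d + 1) (k := k) (by omega) (h.trans d.lt_succ_self)
    simp [h1, h2, h]
  · have h1 := posMoment_succ_lt hd hk h
    have h2 := posMoment_nonneg (d := d + 1) (n := n) (by omega) hk
    refine ⟨h1.le, ?_, ?_⟩ <;> constructor <;> intro <;> omega
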